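/- Let $M$ be a smooth $n$-dimensional manifold and $\lambda:LM\to M$ its bundle of linear frames $u=(x,e_1,\dots,e_n)$, with the right action $(x,e_i)\cdot g=(x,e_j g^j_i)$ of $GL(n,\mathbb R)$. Identify $TM$ with the associated bundle $LM\times_{GL(n,\mathbb R)}\mathbb R^n$ by $[(x,e_i),\xi]=\xi^ie_i\in T_xM$. Let $\tilde TM$ be $TM$ without its zero section, $\tau:\tilde TM\to M$ the projection, and for $0\neq\xi\in\mathbb R^n$ let $\psi_\xi:LM\to\tilde TM$, $\psi_\xi(u)=[u,\xi]$. For $A\in gl(n,\mathbb R)$ let $A^*(u)=\frac{d}{dt}\big|_{t=0}\,u\cdot\exp(tA)$; let $E^i_j$ be the elementary matrix with entry $1$ in row $j$ and column $i$; let $\theta^j_u(X)=e^j(\lambda_*X)$ be the components of the soldering form, where $(e^j)$ is the coframe dual to $u$. The canonical $n$-tangent structure of $LM$ is $(J^i)_u(X)=\big(\sum_jE^i_j\,\theta^j_u(X)\big)^*(u)$. Let $h$ be an arbitrary smooth positive definite metric tensor field on $M$, put $\hat h_{ij}(u)=h(e_i,e_j)$, and let $J_i=\sum_j\hat h_{ij}J^j$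 be the covariant $n$-tangent structure defined by $h$. **Theorem.** For $u\in LM$, $0\ne\xi\in\mathbb R^n$ and $X\in T_{[u,\xi]}\tilde TM$ put $$\mathcal J([u,\xi])(X)=\frac{\psi_{\xi*}\big(\sum_i\xi^iJ_i(u)(\tilde X)\big)}{\sum_{a,b}\hat h_{ab}(u)\,\xi^a\xi^b},$$ where $\tilde X\in T_uLM$ is any tangent vector with $\lambda_*\tilde X=\tau_*X$. Then: 1. the denominator is never zero, every point of $\tilde TM$ is of the form $[u,\xi]$ with $\xi\neq0$, and such an $\tilde X$ always exists; 2. the right-hand side depends only on the point $[u,\xi]$ and on $X$, not on the choice of $u$, $\xi$ and $\tilde X$, and it is linear in $X$, so that $\mathcal J$ is a well-defined vector-valued $1$-form on $\tilde TM$; 3. $\mathcal J$ is the restriction to $\tilde TM$ of the canonical tangent structure of $TM$, $J_v(Z)=(\tau_{M*}Z)^V_v$, where $\tau_M:TM\to M$ is the projection and $X^V_v=\frac{d}{dt}\big|_{t=0}(v+tX)$ is the vertical lift; and in the coordinates $(x^i,y^i)$ of $\tilde TM$ induced by any chart of $M$, $\mathcal J=\sum_i\frac{\partial}{\partial y^i}\otimes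 dx^i$. -/

import Mathlib

open scoped Manifold ContDiff
open Bundle

noncomputable section

namespace FrameTangent

/-- The standard space `ℝⁿ`. -/
abbrev Vec (n : ℕ) : Type := EuclideanSpace ℝ (Fin n)

/-- The standard basis vector `r̂ᵢ` of `ℝⁿ`. -/
def stdVec {n : ℕ} (i : Fin n) : Vec n := EuclideanSpace.single i 1

section Defs

variable {n : ℕ} {M : Type*} [TopologicalSpace M] [ChartedSpace (Vec n) M]
  [IsManifold (𝓡 n) ∞ M]

/-! ### The linear frame bundle -/

variable (n M) in
/-- The manifold of `n`-tuples of tangent vectors at a common point of `M`, as the total space of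
the smooth vector bundle with fibre `Hom(ℝⁿ, TₓM)`: the tuple `(e₁, …, eₙ)` at `x` is the linear map
with `r̂ᵢ ↦ eᵢ`. -/
abbrev TupleBundle : Type _ :=
  TotalSpace (Vec n →L[ℝ] Vec n)
    (fun x : M => Bundle.Trivial M (Vec n) x →L[ℝ] TangentSpace (𝓡 n) x)

/-- The tuples that are frames form an open set. -/
theorem isOpen_frames :
    IsOpen {u : TupleBundle n M | Function.Bijective u.2} := by
  rw [isOpen_iff_mem_nhds]
  intro u hu
  let t := trivializationAt (Vec n →L[ℝ] Vec n)
    (fun x : M => Bundle.Trivial M (Vec n) x →L[ℝ] TangentSpace (𝓡 n) x) u.1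
  have key : ∀ v : TupleBundle n M, v ∈ t.source →
      (Function.Bijective v.2 ↔ IsUnit (t v).2) := by
    intro v hv
    have hv' : v.1 ∈ (trivializationAt (Vec n) (Bundle.Trivial M (Vec n)) u.1).baseSet ∩
        (trivializationAt (Vec n) (TangentSpace (𝓡 n) : M → Type) u.1).baseSet := hv
    have h1 : (t v).2 = ContinuousLinearMap.inCoordinates (Vec n) (Bundle.Trivial M (Vec n))
        (Vec n) (TangentSpace (𝓡 n) : M → Type) u.1 v.1 u.1 v.1 v.2 := rfl
    rw [h1, ContinuousLinearMap.inCoordinates_eq hv'.1 hv'.2, ContinuousLinearMap.isUnit_iff_bijective]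
    let e₁ := (trivializationAt (Vec n) (Bundle.Trivial M (Vec n)) u.1).continuousLinearEquivAt ℝ
      v.1 hv'.1
    let e₂ := (trivializationAt (Vec n) (TangentSpace (𝓡 n) : M → Type) u.1).continuousLinearEquivAt ℝ
      v.1 hv'.2
    exact ((EquivLike.comp_bijective (v.2 ∘ e₁.symm) e₂).trans
      (EquivLike.bijective_comp e₁.symm v.2)).symm
  have hs : t.source ∈ nhds u := t.open_source.mem_nhds (FiberBundle.mem_trivializationAt_proj_source)
  have hc : ContinuousAt (fun v => (t v).2) u :=
    continuous_snd.continuousAt.comp (t.continuousOn_toFun.continuousAt hs)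
  have hu' := (key u (mem_of_mem_nhds hs)).1 hu
  filter_upwards [hs, hc (Units.isOpen.mem_nhds hu')] with v hv hv2
  exact (key v hv).2 hv2

variable (n M) in
/-- The frames, as an open submanifold of the manifold of all `n`-tuples of tangent vectors. -/
def frames : TopologicalSpace.Opens (TupleBundle n M) :=
  ⟨{u | Function.Bijective u.2}, isOpen_frames⟩

variable (n M) in
/-- The linear frame bundle `LM`. -/
abbrev LM : Type _ := frames n M

/-- The model with corners of `LM`. -/
abbrev modelLM (n : ℕ) := (𝓡 n).prod 𝓘(ℝ, Vec n →L[ℝ] Vec n)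

/-- The projection `λ : LM → M`. -/
def LM.proj (u : LM n M) : M := u.1.1

/-- The linear isomorphism `ℝⁿ → TₓM`, `ξ ↦ ξⁱ eᵢ` given by a frame `u = (x, eᵢ)`. -/
def LM.toEquiv (u : LM n M) : Vec n ≃ₗ[ℝ] TangentSpace (𝓡 n) u.proj :=
  LinearEquiv.ofBijective
    (show Vec n →L[ℝ] TangentSpace (𝓡 n) u.proj from u.1.2).toLinearMap u.2

/-- The vector `eᵢ` of the frame `u = (x, eᵢ)`. -/
def LM.vec (u : LM n M) (i : Fin n) : TangentSpace (𝓡 n) u.proj := u.toEquiv (stdVec i)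

/-- The right action of `GL(n, ℝ)`: `(x, eᵢ) · g = (x, eⱼ gʲᵢ)`. -/
def LM.act (u : LM n M) (g : GL (Fin n) ℝ) : LM n M :=
  ⟨⟨u.1.1, (show Vec n →L[ℝ] TangentSpace (𝓡 n) u.1.1 from u.1.2).comp
      (Matrix.toEuclideanCLM (𝕜 := ℝ) (g : Matrix (Fin n) (Fin n) ℝ))⟩, by
    have hg : Function.Bijective (Matrix.toEuclideanCLM (𝕜 := ℝ) (g : Matrix (Fin n) (Fin n) ℝ)) :=
      ContinuousLinearMap.isUnit_iff_bijective.1 (g.isUnit.map _)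
    exact u.2.comp hg⟩

/-- `exp A` as an element of `GL(n, ℝ)`. -/
def expGL {n : ℕ} (A : Matrix (Fin n) (Fin n) ℝ) : GL (Fin n) ℝ := (Matrix.isUnit_exp A).unit

/-- The fundamental vertical vector field `A*(u) = d/dt (u · exp (t A))` at `t = 0`. -/
def fundamental (A : Matrix (Fin n) (Fin n) ℝ) (u : LM n M) : TangentSpace (modelLM n) u :=
  mfderiv 𝓘(ℝ, ℝ) (modelLM n) (fun t : ℝ => u.act (expGL (t • A))) 0 (1 : ℝ)

/-- The soldering form `θʲ_u(X) = eʲ(λ_* X)`, where `(eʲ)` is the coframe dual to `u`. -/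
def soldering (u : LM n M) (X : TangentSpace (modelLM n) u) (j : Fin n) : ℝ :=
  u.toEquiv.symm (mfderiv (modelLM n) (𝓡 n) LM.proj u X) j

/-- The basis element `Eⁱⱼ` of `gl(n, ℝ)`: the one with `eᵢ · Eⁱⱼ = eⱼ`, that is, with its
entry `1` in row `j` and column `i`. -/
def glBasis {n : ℕ} (i j : Fin n) : Matrix (Fin n) (Fin n) ℝ := Matrix.single j i 1

/-- The canonical `n`-tangent structure on `LM`: `Jⁱ_u(X) = (∑ⱼ θʲ_u(X) Eⁱⱼ)*(u)`. -/
def nTangent (i : Fin n) (u : LM n M) (X : TangentSpace (modelLM n) u) :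
    TangentSpace (modelLM n) u :=
  fundamental (∑ j, soldering u X j • glBasis i j) u

/-! ### The covariant structure based on a metric -/

variable (n M) in
/-- Smooth positive definite metric tensor fields on `M`. -/
abbrev Metric : Type _ :=
  ContMDiffRiemannianMetric (𝓡 n) ∞ (Vec n) (fun x : M => TangentSpace (𝓡 n) x)

/-- The functions `ĥᵢⱼ(u) = h(eᵢ, eⱼ)` on `LM`. -/
def hHat (h : Metric n M) (u : LM n M) (i j : Fin n) : ℝ := h.inner u.proj (u.vec i) (u.vec j)

/-- The covariant `n`-tangent structure `Jᵢ = ∑ⱼ ĥᵢⱼ Jʲ` based on `h`. -/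
def covariantTangent (h : Metric n M) (i : Fin n) (u : LM n M) (X : TangentSpace (modelLM n) u) :
    TangentSpace (modelLM n) u :=
  ∑ j, hHat h u i j • nTangent j u X

/-! ### The tangent bundle as an associated bundle -/

/-- The action of `GL(n, ℝ)` on `ℝⁿ`. -/
def glAct {n : ℕ} (g : GL (Fin n) ℝ) (ξ : Vec n) : Vec n :=
  Matrix.toEuclideanCLM (𝕜 := ℝ) (g : Matrix (Fin n) (Fin n) ℝ) ξ

theorem glAct_one {n : ℕ} (ξ : Vec n) : glAct 1 ξ = ξ := by
  simp [glAct]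

theorem glAct_glAct {n : ℕ} (g k : GL (Fin n) ℝ) (ξ : Vec n) :
    glAct g (glAct k ξ) = glAct (g * k) ξ := by
  simp [glAct, map_mul]

theorem act_one (u : LM n M) : u.act 1 = u := by
  apply Subtype.ext
  simp only [LM.act, Units.val_one, map_one]
  rfl

theorem act_act (u : LM n M) (g k : GL (Fin n) ℝ) : (u.act g).act k = u.act (g * k) := by
  apply Subtype.ext
  simp only [LM.act, Units.val_mul, map_mul]
  rfl

theorem toEquiv_act (u : LM n M) (g : GL (Fin n) ℝ) (ξ : Vec n) :
    (u.act g).toEquiv ξ = u.toEquiv (glAct g ξ) := rfl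

variable (n M) in
/-- The equivalence relation `(u, ξ) ∼ (u · g, g⁻¹ ξ)` on `LM × ℝⁿ`. -/
def assocSetoid : Setoid (LM n M × Vec n) where
  r a b := ∃ g : GL (Fin n) ℝ, b = (a.1.act g, glAct g⁻¹ a.2)
  iseqv := by
    refine ⟨fun a => ⟨1, ?_⟩, ?_, ?_⟩
    · simp [act_one, glAct_one]
    · rintro a b ⟨g, rfl⟩
      exact ⟨g⁻¹, by simp [act_act, act_one, glAct_glAct, glAct_one]⟩
    · rintro a b c ⟨g, rfl⟩ ⟨k, rfl⟩
      exact ⟨g * k, by simp [act_act, glAct_glAct]⟩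

variable (n M) in
/-- The bundle `LM ×_{GL(n)} ℝⁿ` associated to `LM` and the standard action. -/
abbrev Assoc : Type _ := Quotient (assocSetoid n M)

/-- The identification of the associated bundle with `TM`: `[(x, eᵢ), ξ] ↦ ξⁱ eᵢ ∈ TₓM`. -/
def Assoc.toTangent : Assoc n M → TangentBundle (𝓡 n) M :=
  Quotient.lift (fun a : LM n M × Vec n => ⟨a.1.proj, a.1.toEquiv a.2⟩) (by
    rintro ⟨u, ξ⟩ _ ⟨g, rfl⟩
    have h1 : (u.act g).toEquiv (glAct g⁻¹ ξ) = u.toEquiv ξ := by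
      rw [toEquiv_act, glAct_glAct, mul_inv_cancel, glAct_one]
    exact congrArg (fun w => (⟨u.proj, w⟩ : TangentBundle (𝓡 n) M)) h1.symm)

theorem Assoc.toTangent_bijective :
    Function.Bijective (Assoc.toTangent : Assoc n M → TangentBundle (𝓡 n) M) := by
  constructor
  · rintro ⟨⟨⟨x, a⟩, ha⟩, ξ⟩ ⟨⟨⟨y, b⟩, hb⟩, η⟩ h
    obtain rfl : x = y := congrArg TotalSpace.proj h
    have h2 : a ξ = b η := by
      injection h with _ h2
    let u : LM n M := ⟨⟨x, a⟩, ha⟩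
    let w : LM n M := ⟨⟨x, b⟩, hb⟩
    let c : Vec n ≃ₗ[ℝ] Vec n := w.toEquiv.trans u.toEquiv.symm
    have hc : ∀ v, a (c v) = b v := fun v => u.toEquiv.apply_symm_apply (w.toEquiv v)
    let A : Matrix (Fin n) (Fin n) ℝ :=
      (Matrix.toEuclideanCLM (𝕜 := ℝ)).symm (LinearMap.toContinuousLinearMap (c : Vec n →ₗ[ℝ] Vec n))
    have hA : Matrix.toEuclideanCLM (𝕜 := ℝ) A =
        LinearMap.toContinuousLinearMap (c : Vec n →ₗ[ℝ] Vec n) :=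
      (Matrix.toEuclideanCLM (𝕜 := ℝ)).apply_symm_apply _
    have hAu : IsUnit A := by
      have hbij : IsUnit (LinearMap.toContinuousLinearMap (c : Vec n →ₗ[ℝ] Vec n)) :=
        ContinuousLinearMap.isUnit_iff_bijective.2 c.bijective
      exact hbij.map (Matrix.toEuclideanCLM (n := Fin n) (𝕜 := ℝ)).symm
    have hg : ∀ v, glAct hAu.unit v = c v := fun v => DFunLike.congr_fun hA v
    refine Quotient.sound ⟨hAu.unit, Prod.ext ?_ ?_⟩
    · apply Subtype.ext
      refine congrArg (fun l => (⟨x, l⟩ : TupleBundle n M)) ?_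
      refine ContinuousLinearMap.ext fun v => ?_
      exact (hc v).symm.trans (congrArg a (hg v).symm)
    · have h3 : glAct hAu.unit η = ξ := ha.1 ((congrArg a (hg η)).trans ((hc η).trans h2.symm))
      change η = glAct hAu.unit⁻¹ ξ
      rw [← h3, glAct_glAct, inv_mul_cancel, glAct_one]
  · rintro ⟨x, v⟩
    exact ⟨Quotient.mk _ (⟨⟨x, ContinuousLinearMap.id ℝ (Vec n)⟩, Function.bijective_id⟩, v), rfl⟩

/-- The vectors away from the zero section form an open set. -/
theorem isOpen_slit : IsOpen {v : TangentBundle (𝓡 n) M | v.2 ≠ 0} := by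
  rw [isOpen_iff_mem_nhds]
  intro u hu
  let t := trivializationAt (Vec n) (TangentSpace (𝓡 n) : M → Type) u.1
  have key : ∀ v : TangentBundle (𝓡 n) M, v ∈ t.source → (v.2 ≠ 0 ↔ (t v).2 ≠ 0) := by
    intro v hv
    have hv' : v.1 ∈ t.baseSet := t.mem_source.1 hv
    have h1 : (t v).2 = t.continuousLinearEquivAt ℝ v.1 hv' v.2 := rfl
    rw [h1, Ne, Ne, EmbeddingLike.map_eq_zero_iff]
  have hs : t.source ∈ nhds u := t.open_source.mem_nhds (FiberBundle.mem_trivializationAt_proj_source)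
  have hc : ContinuousAt (fun v => (t v).2) u :=
    continuous_snd.continuousAt.comp (t.continuousOn_toFun.continuousAt hs)
  have hu' := (key u (mem_of_mem_nhds hs)).1 hu
  filter_upwards [hs, hc (isOpen_ne.mem_nhds hu')] with v hv hv2
  exact (key v hv).2 hv2

variable (n M) in
/-- The complement of the zero section in `TM`. -/
def slit : TopologicalSpace.Opens (TangentBundle (𝓡 n) M) := ⟨{v | v.2 ≠ 0}, isOpen_slit⟩

variable (n M) in
/-- The manifold `T̃M`: the tangent bundle without its zero section, an open submanifold of `TM`. -/
abbrev SlitTM : Type _ := slit n M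

/-- The map `ψ_ξ : LM → T̃M`, `u ↦ [u, ξ]`, for `ξ ≠ 0`. -/
def psi (ξ : Vec n) (hξ : ξ ≠ 0) (u : LM n M) : SlitTM n M :=
  ⟨Assoc.toTangent (Quotient.mk (assocSetoid n M) (u, ξ)),
    fun h0 => hξ ((LinearEquiv.map_eq_zero_iff u.toEquiv).1 h0)⟩

/-- The projection `τ : T̃M → M`. -/
def SlitTM.proj (p : SlitTM n M) : M := p.1.1

/-! ### The canonical tangent structure -/

/-- The vertical lift `X^V(v) = d/dt (v + t X)` at `t = 0`, for `v, X ∈ TₓM`. -/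
def verticalLift (v : TangentBundle (𝓡 n) M) (X : TangentSpace (𝓡 n) v.1) :
    TangentSpace (𝓡 n).tangent v :=
  mfderiv 𝓘(ℝ, ℝ) (𝓡 n).tangent
    (fun t : ℝ => (⟨v.1, v.2 + t • X⟩ : TangentBundle (𝓡 n) M)) 0 (1 : ℝ)

/-- The canonical tangent structure on `TM`: `J_v(Z) = (τ_* Z)^V(v)`. -/
def canonicalTangent (v : TangentBundle (𝓡 n) M) (Z : TangentSpace (𝓡 n).tangent v) :
    TangentSpace (𝓡 n).tangent v :=
  verticalLift v
    (mfderiv (𝓡 n).tangent (𝓡 n) (fun w : TangentBundle (𝓡 n) M => w.1) v Z)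

/-- The coordinates `(x, y)` on `T̃M` induced by a chart `e` of `M`:
`xⁱ(v) = eⁱ(τ(v))` and `yⁱ(v) = v(eⁱ)`. They are meaningful over the domain of `e`. -/
def bundleCoord (e : OpenPartialHomeomorph M (Vec n)) (p : SlitTM n M) : Vec n × Vec n :=
  (e p.proj, mfderiv (𝓡 n) 𝓘(ℝ, Vec n) e p.proj p.1.2)

/-- The coordinate differential `dxⁱ` on `T̃M`. -/
def dx (e : OpenPartialHomeomorph M (Vec n)) (i : Fin n) (p : SlitTM n M)
    (X : TangentSpace (𝓡 n).tangent p) : ℝ :=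
  mfderiv (𝓡 n).tangent 𝓘(ℝ, ℝ) (fun q : SlitTM n M => (bundleCoord e q).1 i) p X

/-- The coordinate vector field `∂/∂yⁱ` on `T̃M`: the tangent vector whose components in the
coordinates `(x, y)` are `(0, r̂ᵢ)`. -/
def partialY (e : OpenPartialHomeomorph M (Vec n)) (i : Fin n) (p : SlitTM n M) :
    TangentSpace (𝓡 n).tangent p :=
  (mfderiv (𝓡 n).tangent 𝓘(ℝ, Vec n × Vec n) (bundleCoord e) p).inverse
    ((0, stdVec i) : Vec n × Vec n)

end Defs

end FrameTangent

end

/-!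
A frame `u` identifies `ℝⁿ` with a fibre of `TM` by the linear map `η ↦ [u, η]`, whose derivative
at `ξ` sends `η` to the vertical lift `(u η)^V` at `[u, ξ]`. As
`ψ_ξ (u · exp (t A)) = [u, exp (t A) ξ]`, it follows that `ψ_ξ* (A* (u)) = (u (A ξ))^V`. For the
matrix `A = ∑ₖ θᵏ(X̃) Eʲₖ` one has `u (A ξ) = ξʲ λ_* X̃`, so that `ψ_ξ* (Jʲ X̃) = ξʲ (λ_* X̃)^V`.
Contracting with `ξⁱ ĥᵢⱼ` yields `(∑ ĥᵢⱼ ξⁱ ξʲ) (λ_* X̃)^V`, whose coefficient is the denominator,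
and `λ_* X̃ = τ_* X`: the formula computes `(τ_* X)^V`, whatever `u`, `ξ` and `X̃` are. In the
coordinates induced by a chart `e` the vertical lift of `w` is `(0, e_* w)`, hence
`𝒥 = ∑ᵢ ∂/∂yⁱ ⊗ dxⁱ`.
-/

open scoped Topology

noncomputable section

namespace FrameTangent

section LinearAlgebra

theorem map_sum_smul_sum_smul {ι R V W : Type*} [Fintype ι] [CommSemiring R] [AddCommMonoid V]
    [Module R V] [AddCommMonoid W] [Module R W] (L : V →ₗ[R] W) {N : ι → V} {ξ : ι → R} {w : W}
    (hL : ∀ j, L (N j) = ξ j • w) (H : ι → ι → R) :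
    L (∑ i, ξ i • ∑ j, H i j • N j) = (∑ i, ∑ j, H i j * ξ i * ξ j) • w := by
  simp only [map_sum, map_smul, hL, Finset.smul_sum, Finset.sum_smul, smul_smul]
  exact Finset.sum_congr rfl fun a _ => Finset.sum_congr rfl fun b _ => by congr 1; ring

theorem toEuclideanCLM_exp {𝕜 m : Type*} [RCLike 𝕜] [Fintype m] [DecidableEq m]
    (A : Matrix m m 𝕜) :
    Matrix.toEuclideanCLM (𝕜 := 𝕜) (NormedSpace.exp A) =
      NormedSpace.exp (Matrix.toEuclideanCLM (𝕜 := 𝕜) A) := by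
  open scoped Matrix.Norms.Operator in
  refine NormedSpace.map_exp (Matrix.toEuclideanCLM (n := m) (𝕜 := 𝕜)) ?_ A
  exact LinearMap.continuous_of_finiteDimensional
    (Matrix.toEuclideanCLM (n := m) (𝕜 := 𝕜)).toAlgEquiv.toLinearMap

theorem hasDerivAt_exp_smul_apply {𝕜 V : Type*} [RCLike 𝕜] [NormedAddCommGroup V]
    [NormedSpace 𝕜 V] [CompleteSpace V] (B : V →L[𝕜] V) (v : V) :
    HasDerivAt (fun t : 𝕜 => NormedSpace.exp (t • B) v) (B v) 0 := by
  have h := (hasDerivAt_exp_smul_const B (0 : 𝕜)).clm_apply (hasDerivAt_const 0 v)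
  rwa [zero_smul, NormedSpace.exp_zero, one_mul, map_zero, add_zero] at h

end LinearAlgebra

section OpenSubmanifold

variable {𝕜 E H M : Type*} [NontriviallyNormedField 𝕜] [NormedAddCommGroup E] [NormedSpace 𝕜 E]
  [TopologicalSpace H] {I : ModelWithCorners 𝕜 E H} [TopologicalSpace M] [ChartedSpace H M]
  {U : TopologicalSpace.Opens M}

variable (I) in
/-- The identification of the tangent spaces of an open submanifold `U ⊆ M` with those of `M`. It is
the identity of the model space, because the preferred chart of `U` at `p` is the restriction of the
preferred chart of `M` at `p`. -/
def opensTangentEquiv (p : U) : TangentSpace I p ≃L[𝕜] TangentSpace I (p : M) :=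
  ContinuousLinearEquiv.refl 𝕜 E

theorem hasMFDerivAt_subtype_val (p : U) :
    HasMFDerivAt I I (Subtype.val : U → M) p (opensTangentEquiv I p : _ →L[𝕜] _) := by
  refine ⟨continuousAt_subtype_val, HasFDerivWithinAt.congr_of_eventuallyEq
    (hasFDerivWithinAt_id (𝕜 := 𝕜) (extChartAt I p p) (Set.range I)) ?_ ?_⟩
  · filter_upwards [extChartAt_target_mem_nhdsWithin (I := I) p] with z hz
    exact (extChartAt I p).right_inv hz
  · exact (extChartAt I p).right_inv (mem_extChartAt_target p)

theorem mfderiv_subtype_val (p : U) :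
    mfderiv I I (Subtype.val : U → M) p = opensTangentEquiv I p :=
  (hasMFDerivAt_subtype_val p).mfderiv

theorem mfderiv_comp_subtype_val {E' H' M' : Type*} [NormedAddCommGroup E'] [NormedSpace 𝕜 E']
    [TopologicalSpace H'] {I' : ModelWithCorners 𝕜 E' H'} [TopologicalSpace M'] [ChartedSpace H' M']
    {g : M → M'} {p : U} (hg : MDifferentiableAt I I' g p) :
    mfderiv I I' (fun q : U => g q) p =
      (mfderiv I I' g p).comp (opensTangentEquiv I p).toContinuousLinearMap :=
  (hg.hasMFDerivAt.comp p (hasMFDerivAt_subtype_val p)).mfderiv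

end OpenSubmanifold

section Fiber

variable {𝕜 B F : Type*} {E : B → Type*} [NontriviallyNormedField 𝕜]
  [NormedAddCommGroup F] [NormedSpace 𝕜 F] [TopologicalSpace (TotalSpace F E)]
  [∀ x, TopologicalSpace (E x)] [TopologicalSpace B] [FiberBundle F E]
  {EB HB : Type*} [NormedAddCommGroup EB] [NormedSpace 𝕜 EB] [TopologicalSpace HB]
  {IB : ModelWithCorners 𝕜 EB HB} [ChartedSpace HB B]
  [∀ x, AddCommMonoid (E x)] [∀ x, Module 𝕜 (E x)] [VectorBundle 𝕜 F E]

theorem contMDiff_totalSpaceMk_comp_clm {V : Type*} [NormedAddCommGroup V] [NormedSpace 𝕜 V]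
    {k : ℕ∞ω} {b : B} (T : V →L[𝕜] E b) :
    ContMDiff 𝓘(𝕜, V) (IB.prod 𝓘(𝕜, F)) k fun w => (⟨b, T w⟩ : TotalSpace F E) := by
  intro w
  refine contMDiffAt_totalSpace.2 ⟨contMDiffAt_const, ?_⟩
  let t := trivializationAt F E b
  have ht : b ∈ t.baseSet := mem_baseSet_trivializationAt F E b
  refine (((t.continuousLinearMapAt 𝕜 b).comp T).contMDiff.contMDiffAt).congr_of_eventuallyEq ?_
  filter_upwards with z
  exact (t.continuousLinearMapAt_apply_of_mem 𝕜 ht (T z)).symm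

theorem mfderiv_eq_of_forall_eq_totalSpaceMk {V : Type*} [NormedAddCommGroup V] [NormedSpace 𝕜 V]
    {b : B} (T : V →L[𝕜] E b) {f : 𝕜 → TotalSpace F E} {c : 𝕜 → V} {t : 𝕜} {w z : V}
    (hf : ∀ s, f s = ⟨b, T (c s)⟩) (hc : HasDerivAt c z t) (hw : c t = w) :
    (mfderiv 𝓘(𝕜, 𝕜) (IB.prod 𝓘(𝕜, F)) f t (1 : 𝕜) : EB × F) =
      mfderiv 𝓘(𝕜, V) (IB.prod 𝓘(𝕜, F)) (fun w => (⟨b, T w⟩ : TotalSpace F E)) w z := by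
  obtain rfl : f = (fun w => ⟨b, T w⟩) ∘ c := funext hf
  have hT : MDifferentiableAt 𝓘(𝕜, V) (IB.prod 𝓘(𝕜, F)) (fun w => (⟨b, T w⟩ : TotalSpace F E)) w :=
    (contMDiff_totalSpaceMk_comp_clm (k := 1) T).mdifferentiableAt one_ne_zero
  have hc' : HasMFDerivAt 𝓘(𝕜, 𝕜) 𝓘(𝕜, V) c t (ContinuousLinearMap.toSpanSingleton 𝕜 z) :=
    hc.hasFDerivAt.hasMFDerivAt
  have hz : mfderiv 𝓘(𝕜, 𝕜) 𝓘(𝕜, V) c t (1 : 𝕜) = z := by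
    rw [hc'.mfderiv]
    exact one_smul 𝕜 z
  subst hw
  exact (mfderiv_comp_apply t hT hc'.mdifferentiableAt (1 : 𝕜)).trans (congrArg _ hz)

theorem surjective_mfderiv_proj [ContMDiffVectorBundle 1 F E IB]
    (v : TotalSpace F E) :
    Function.Surjective
      (mfderiv (IB.prod 𝓘(𝕜, F)) IB (TotalSpace.proj : TotalSpace F E → B) v) := by
  let t := trivializationAt F E v.proj
  let s : B → TotalSpace F E := fun b => t.toOpenPartialHomeomorph.symm (b, (t v).2)
  have hv : v.proj ∈ t.baseSet := mem_baseSet_trivializationAt F E v.proj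
  have hsv : s v.proj = v := t.symm_apply_mk_proj (t.mem_source.2 hv)
  have hs : MDifferentiableAt IB (IB.prod 𝓘(𝕜, F)) s v.proj := by
    refine ContMDiffAt.mdifferentiableAt (n := 1) ?_ one_ne_zero
    refine ((t.contMDiffOn_symm (IB := IB) (n := 1)).contMDiffAt ?_).comp v.proj
      (contMDiffAt_id.prodMk contMDiffAt_const)
    exact t.open_target.mem_nhds (t.mem_target.2 hv)
  have hπs : TotalSpace.proj ∘ s =ᶠ[𝓝 v.proj] id := by
    filter_upwards [t.open_baseSet.mem_nhds hv] with b hb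
    exact t.proj_symm_apply' hb
  intro w
  refine ⟨mfderiv IB (IB.prod 𝓘(𝕜, F)) s v.proj w, ?_⟩
  have hπ := (contMDiffAt_proj (IB := IB) E (n := 1) (p := v)).mdifferentiableAt one_ne_zero
  rw [← mfderiv_comp_apply_of_eq v.proj hπ hs hsv, hπs.mfderiv_eq, mfderiv_id]
  rfl

end Fiber

section Vertical

variable {n : ℕ} {M : Type*} [TopologicalSpace M] [ChartedSpace (Vec n) M]
  [IsManifold (𝓡 n) ∞ M]

theorem verticalLift_eq_mfderiv {V : Type*} [NormedAddCommGroup V] [NormedSpace ℝ V]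
    {v : TangentBundle (𝓡 n) M} (T : V →L[ℝ] TangentSpace (𝓡 n) v.1) {w : V} (hw : T w = v.2)
    (z : V) :
    verticalLift v (T z) =
      mfderiv 𝓘(ℝ, V) (𝓡 n).tangent (fun w => (⟨v.1, T w⟩ : TangentBundle (𝓡 n) M)) w z := by
  refine mfderiv_eq_of_forall_eq_totalSpaceMk T (c := fun t => w + t • z) (fun t => ?_) ?_ ?_
  · simp only [map_add, map_smul, hw]
  · simpa only [one_smul, id_eq] using ((hasDerivAt_id (0 : ℝ)).smul_const z).const_add w
  · simp only [zero_smul, add_zero]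

variable (n) in
/-- The identification of the model space with a tangent space given by the preferred
trivialization of the tangent bundle. It serves to write the tangent vectors at `x` as the values of
a linear map defined on a normed space. -/
def modelTangentEquiv (x : M) : Vec n ≃L[ℝ] TangentSpace (𝓡 n) x :=
  ((trivializationAt (Vec n) (TangentSpace (𝓡 n) : M → Type) x).continuousLinearEquivAt ℝ x
    (mem_baseSet_trivializationAt (Vec n) (TangentSpace (𝓡 n) : M → Type) x)).symm

/-- The vertical lift to `v` as a continuous linear map, the derivative of the inclusion of the
fibre through `v`. -/
def verticalLiftCLM (v : TangentBundle (𝓡 n) M) :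
    TangentSpace (𝓡 n) v.1 →L[ℝ] TangentSpace (𝓡 n).tangent v :=
  (mfderiv 𝓘(ℝ, Vec n) (𝓡 n).tangent
    (fun w => (⟨v.1, modelTangentEquiv n v.1 w⟩ : TangentBundle (𝓡 n) M))
    ((modelTangentEquiv n v.1).symm v.2)).comp (modelTangentEquiv n v.1).symm.toContinuousLinearMap

theorem verticalLiftCLM_apply (v : TangentBundle (𝓡 n) M) (X : TangentSpace (𝓡 n) v.1) :
    verticalLiftCLM v X = verticalLift v X := by
  have h := verticalLift_eq_mfderiv (modelTangentEquiv n v.1).toContinuousLinearMap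
    ((modelTangentEquiv n v.1).apply_symm_apply v.2) ((modelTangentEquiv n v.1).symm X)
  rw [ContinuousLinearEquiv.coe_coe, ContinuousLinearEquiv.apply_symm_apply] at h
  exact h.symm

theorem verticalLift_smul (v : TangentBundle (𝓡 n) M) (a : ℝ) (X : TangentSpace (𝓡 n) v.1) :
    verticalLift v (a • X) = a • verticalLift v X := by
  simp only [← verticalLiftCLM_apply, map_smul]

/-- The canonical tangent structure of `TM` as a field of continuous linear maps. -/
def canonicalTangentCLM (v : TangentBundle (𝓡 n) M) :
    TangentSpace (𝓡 n).tangent v →L[ℝ] TangentSpace (𝓡 n).tangent v :=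
  (verticalLiftCLM v).comp
    (mfderiv (𝓡 n).tangent (𝓡 n) (fun w : TangentBundle (𝓡 n) M => w.1) v)

theorem canonicalTangentCLM_apply (v : TangentBundle (𝓡 n) M) (Z : TangentSpace (𝓡 n).tangent v) :
    canonicalTangentCLM v Z = canonicalTangent v Z :=
  verticalLiftCLM_apply v _

/-- The restriction to `T̃M` of the canonical tangent structure of `TM`. -/
def slitTangent (p : SlitTM n M) :
    TangentSpace (𝓡 n).tangent p →L[ℝ] TangentSpace (𝓡 n).tangent p :=
  (opensTangentEquiv (𝓡 n).tangent p).symm.toContinuousLinearMap.comp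
    ((canonicalTangentCLM p.1).comp (opensTangentEquiv (𝓡 n).tangent p).toContinuousLinearMap)

theorem opensTangentEquiv_slitTangent (p : SlitTM n M) (X : TangentSpace (𝓡 n).tangent p) :
    opensTangentEquiv (𝓡 n).tangent p (slitTangent p X) =
      canonicalTangent p.1 (opensTangentEquiv (𝓡 n).tangent p X) :=
  ((opensTangentEquiv (𝓡 n).tangent p).apply_symm_apply _).trans (canonicalTangentCLM_apply _ _)

theorem mfderiv_subtype_val_slitTangent (p : SlitTM n M) (X : TangentSpace (𝓡 n).tangent p) :
    mfderiv (𝓡 n).tangent (𝓡 n).tangent (Subtype.val : SlitTM n M → TangentBundle (𝓡 n) M) p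
        (slitTangent p X) =
      canonicalTangent p.1 (mfderiv (𝓡 n).tangent (𝓡 n).tangent
        (Subtype.val : SlitTM n M → TangentBundle (𝓡 n) M) p X) := by
  rw [mfderiv_subtype_val]
  exact opensTangentEquiv_slitTangent p X

variable (M) in
theorem mdifferentiable_tangentBundle_proj :
    MDifferentiable (𝓡 n).tangent (𝓡 n) (fun v : TangentBundle (𝓡 n) M => v.1) :=
  (contMDiff_proj (TangentSpace (𝓡 n) : M → Type) (n := 1)).mdifferentiable one_ne_zero

theorem mfderiv_slit_proj (p : SlitTM n M) :
    mfderiv (𝓡 n).tangent (𝓡 n) SlitTM.proj p =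
      (mfderiv (𝓡 n).tangent (𝓡 n) (fun v : TangentBundle (𝓡 n) M => v.1) p.1).comp
        (opensTangentEquiv (𝓡 n).tangent p).toContinuousLinearMap :=
  mfderiv_comp_subtype_val (mdifferentiable_tangentBundle_proj M p.1)

theorem surjective_mfderiv_LM_proj (u : LM n M) :
    Function.Surjective (mfderiv (modelLM n) (𝓡 n) LM.proj u) := by
  have h : mfderiv (modelLM n) (𝓡 n) LM.proj u =
      (mfderiv (modelLM n) (𝓡 n) (fun v : TupleBundle n M => v.1) u.1).comp
        (opensTangentEquiv (modelLM n) u).toContinuousLinearMap :=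
    mfderiv_comp_subtype_val ((contMDiff_proj _ (n := 1)).mdifferentiable one_ne_zero u.1)
  rw [h]
  exact (surjective_mfderiv_proj u.1).comp (opensTangentEquiv (modelLM n) u).surjective

end Vertical

section Frames

variable {n : ℕ} {M : Type*} [TopologicalSpace M] [ChartedSpace (Vec n) M]
  [IsManifold (𝓡 n) ∞ M]

theorem expGL_zero : expGL (0 : Matrix (Fin n) (Fin n) ℝ) = 1 :=
  Units.ext NormedSpace.exp_zero

/-- The isomorphism `ξ ↦ ξⁱ eᵢ` given by a frame, as a continuous linear map. -/
def LM.toCLM (u : LM n M) : Vec n →L[ℝ] TangentSpace (𝓡 n) u.proj := u.1.2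

theorem act_expGL_val (u : LM n M) (A : Matrix (Fin n) (Fin n) ℝ) :
    (u.act (expGL A) : TupleBundle n M) =
      ⟨u.proj, u.toCLM.comp (NormedSpace.exp (Matrix.toEuclideanCLM (𝕜 := ℝ) A))⟩ := by
  rw [← toEuclideanCLM_exp]
  rfl

theorem contMDiff_act_expGL (u : LM n M) (A : Matrix (Fin n) (Fin n) ℝ) :
    ContMDiff 𝓘(ℝ, ℝ) (modelLM n) ∞ fun t : ℝ => u.act (expGL (t • A)) := by
  rw [← ContMDiff.subtypeVal_comp_iff]
  have hexp : ContDiff ℝ ∞ fun t : ℝ =>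
      NormedSpace.exp (t • Matrix.toEuclideanCLM (n := Fin n) (𝕜 := ℝ) A) :=
    contDiff_iff_contDiffAt.2 fun t => (NormedSpace.exp_analytic _).contDiffAt.comp t
      (contDiff_id.smul contDiff_const).contDiffAt
  refine ((contMDiff_totalSpaceMk_comp_clm (u.toCLM.postcomp (Vec n))).comp
    hexp.contMDiff).congr fun t => ?_
  rw [Function.comp_apply, act_expGL_val, map_smul]
  rfl

theorem contMDiff_psi (ξ : Vec n) (hξ : ξ ≠ 0) :
    ContMDiff (modelLM n) (𝓡 n).tangent ∞ (psi ξ hξ : LM n M → SlitTM n M) := by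
  rw [← ContMDiff.subtypeVal_comp_iff]
  have hconst : ContMDiff (modelLM n) ((𝓡 n).prod 𝓘(ℝ, Vec n)) ∞ fun u : TupleBundle n M =>
      (⟨u.1, ξ⟩ : TotalSpace (Vec n) (Bundle.Trivial M (Vec n))) := fun u =>
    contMDiffAt_totalSpace.2 ⟨contMDiffAt_proj _, contMDiffAt_const⟩
  exact (ContMDiff.clm_bundle_apply (b := fun u : TupleBundle n M => u.1) (ϕ := fun u => u.2)
    contMDiff_id hconst).comp contMDiff_subtype_val

theorem mfderiv_psi_fundamental (ξ : Vec n) (hξ : ξ ≠ 0) (u : LM n M)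
    (A : Matrix (Fin n) (Fin n) ℝ) :
    opensTangentEquiv (𝓡 n).tangent (psi ξ hξ u)
        (mfderiv (modelLM n) (𝓡 n).tangent (psi ξ hξ) u (fundamental A u)) =
      verticalLift (psi ξ hξ u).1 (u.toEquiv (Matrix.toEuclideanCLM (𝕜 := ℝ) A ξ)) := by
  let B : Vec n →L[ℝ] Vec n := Matrix.toEuclideanCLM (𝕜 := ℝ) A
  let γ : ℝ → LM n M := fun t => u.act (expGL (t • A))
  let φ : LM n M → TangentBundle (𝓡 n) M := fun w => (psi ξ hξ w).1
  have hγ : MDifferentiableAt 𝓘(ℝ, ℝ) (modelLM n) γ 0 :=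
    (contMDiff_act_expGL u A).mdifferentiable (by simp) 0
  have hγ0 : γ 0 = u := by
    simp only [γ, zero_smul, expGL_zero, act_one]
  have hψ : MDifferentiableAt (modelLM n) (𝓡 n).tangent (psi ξ hξ : LM n M → SlitTM n M) u :=
    (contMDiff_psi ξ hξ).mdifferentiable (by simp) u
  have hφ : HasMFDerivAt (modelLM n) (𝓡 n).tangent φ u _ :=
    (hasMFDerivAt_subtype_val (psi ξ hξ u)).comp u hψ.hasMFDerivAt
  have hφγ : ∀ t, (φ ∘ γ) t = ⟨u.proj, u.toCLM (NormedSpace.exp (t • B) ξ)⟩ := fun t => by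
    simp only [B, ← map_smul, ← toEuclideanCLM_exp]
    rfl
  have hexp : NormedSpace.exp ((0 : ℝ) • B) ξ = ξ := by
    rw [zero_smul ℝ B, NormedSpace.exp_zero, one_apply_eq_self]
  have hcurve := mfderiv_eq_of_forall_eq_totalSpaceMk (IB := 𝓡 n) u.toCLM hφγ
    (hasDerivAt_exp_smul_apply B ξ) hexp
  have hchain := mfderiv_comp_apply_of_eq (0 : ℝ) hφ.mdifferentiableAt hγ hγ0 (1 : ℝ)
  rw [hφ.mfderiv] at hchain
  exact (hchain.symm.trans hcurve).trans
    (verticalLift_eq_mfderiv (v := (psi ξ hξ u).1) u.toCLM rfl (B ξ)).symm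

theorem sum_smul_stdVec (ξ : Vec n) : ∑ i, ξ i • stdVec i = ξ := by
  ext j
  simp [stdVec, Pi.single_apply]

theorem toEuclideanCLM_sum_glBasis (j : Fin n) (θ ξ : Vec n) :
    Matrix.toEuclideanCLM (𝕜 := ℝ) (∑ k, θ k • glBasis j k) ξ = ξ j • θ := by
  ext i
  simp [glBasis, Matrix.ofLp_toEuclideanCLM, Matrix.mulVec, dotProduct,
    Matrix.single_apply, mul_comm, ite_and]

theorem mfderiv_psi_nTangent (ξ : Vec n) (hξ : ξ ≠ 0) (u : LM n M) (j : Fin n)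
    (X : TangentSpace (modelLM n) u) :
    opensTangentEquiv (𝓡 n).tangent (psi ξ hξ u)
        (mfderiv (modelLM n) (𝓡 n).tangent (psi ξ hξ) u (nTangent j u X)) =
      ξ j • verticalLift (psi ξ hξ u).1 (mfderiv (modelLM n) (𝓡 n) LM.proj u X) := by
  have hA : Matrix.toEuclideanCLM (𝕜 := ℝ) (∑ k, soldering u X k • glBasis j k) ξ =
      ξ j • u.toEquiv.symm (mfderiv (modelLM n) (𝓡 n) LM.proj u X) :=
    toEuclideanCLM_sum_glBasis j _ ξ
  rw [nTangent, mfderiv_psi_fundamental, hA, map_smul, LinearEquiv.apply_symm_apply]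
  exact verticalLift_smul _ _ _

theorem sum_hHat_eq_inner (h : Metric n M) (u : LM n M) (ξ : Vec n) :
    ∑ a, ∑ b, hHat h u a b * ξ a * ξ b = h.inner u.proj (u.toEquiv ξ) (u.toEquiv ξ) := by
  have hξ : u.toEquiv ξ = ∑ i, ξ i • u.vec i := by
    conv_lhs => rw [← sum_smul_stdVec ξ]
    simp only [map_sum, map_smul, LM.vec]
  rw [hξ]
  simp only [map_sum, map_smul, _root_.sum_apply, _root_.smul_apply, smul_eq_mul, hHat,
    Finset.mul_sum]
  rw [Finset.sum_comm]
  exact Finset.sum_congr rfl fun a _ => Finset.sum_congr rfl fun b _ => by ring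

theorem sum_hHat_ne_zero (h : Metric n M) (u : LM n M) {ξ : Vec n} (hξ : ξ ≠ 0) :
    ∑ a, ∑ b, hHat h u a b * ξ a * ξ b ≠ 0 := by
  rw [sum_hHat_eq_inner]
  exact (h.pos _ _ ((LinearEquiv.map_ne_zero_iff u.toEquiv).2 hξ)).ne'

theorem mfderiv_psi_sum_covariantTangent (h : Metric n M) (ξ : Vec n) (hξ : ξ ≠ 0) (u : LM n M)
    (X : TangentSpace (modelLM n) u) :
    opensTangentEquiv (𝓡 n).tangent (psi ξ hξ u)
        (mfderiv (modelLM n) (𝓡 n).tangent (psi ξ hξ) u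
          (∑ i, ξ i • covariantTangent h i u X)) =
      (∑ a, ∑ b, hHat h u a b * ξ a * ξ b) •
        verticalLift (psi ξ hξ u).1 (mfderiv (modelLM n) (𝓡 n) LM.proj u X) :=
  map_sum_smul_sum_smul ((opensTangentEquiv (𝓡 n).tangent (psi ξ hξ u)).toLinearMap ∘ₗ
    (mfderiv (modelLM n) (𝓡 n).tangent (psi ξ hξ) u).toLinearMap)
    (fun j => mfderiv_psi_nTangent ξ hξ u j X) (hHat h u)

theorem slitTangent_psi_eq (h : Metric n M) (u : LM n M) (ξ : Vec n) (hξ : ξ ≠ 0)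
    (X : TangentSpace (𝓡 n).tangent (psi ξ hξ u)) (X' : TangentSpace (modelLM n) u)
    (hX : (mfderiv (modelLM n) (𝓡 n) LM.proj u X' : TangentSpace (𝓡 n) u.proj) =
      mfderiv (𝓡 n).tangent (𝓡 n) SlitTM.proj (psi ξ hξ u) X) :
    slitTangent (psi ξ hξ u) X = (∑ a, ∑ b, hHat h u a b * ξ a * ξ b)⁻¹ •
      mfderiv (modelLM n) (𝓡 n).tangent (psi ξ hξ) u (∑ i, ξ i • covariantTangent h i u X') := by
  apply (opensTangentEquiv (𝓡 n).tangent (psi ξ hξ u)).injective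
  rw [map_smul, mfderiv_psi_sum_covariantTangent, inv_smul_smul₀ (sum_hHat_ne_zero h u hξ), hX,
    mfderiv_slit_proj]
  exact opensTangentEquiv_slitTangent _ X

theorem exists_psi_eq (p : SlitTM n M) :
    ∃ (u : LM n M) (ξ : Vec n) (hξ : ξ ≠ 0), psi ξ hξ u = p :=
  ⟨⟨⟨p.proj, ContinuousLinearMap.id ℝ (Vec n)⟩, Function.bijective_id⟩, p.1.2, p.2, rfl⟩

theorem exists_mfderiv_LM_proj_eq (u : LM n M) (ξ : Vec n) (hξ : ξ ≠ 0)
    (X : TangentSpace (𝓡 n).tangent (psi ξ hξ u)) :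
    ∃ X' : TangentSpace (modelLM n) u,
      (mfderiv (modelLM n) (𝓡 n) LM.proj u X' : TangentSpace (𝓡 n) u.proj) =
        mfderiv (𝓡 n).tangent (𝓡 n) SlitTM.proj (psi ξ hξ u) X :=
  surjective_mfderiv_LM_proj u _

end Frames

section Coordinates

variable {n : ℕ} {M : Type*} [TopologicalSpace M] [ChartedSpace (Vec n) M]
  {e : OpenPartialHomeomorph M (Vec n)}

theorem mdifferentiable_of_mem_maximalAtlas (he : e ∈ IsManifold.maximalAtlas (𝓡 n) ∞ M) :
    e.MDifferentiable (𝓡 n) (𝓡 n) :=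
  ⟨(contMDiffOn_of_mem_maximalAtlas he).mdifferentiableOn (by simp),
    (contMDiffOn_symm_of_mem_maximalAtlas he).mdifferentiableOn (by simp)⟩

variable [IsManifold (𝓡 n) ∞ M]

/-- The coordinates `(x, y)` on `TM` induced by a chart `e` of `M`, of which `bundleCoord e` is the
restriction to `T̃M`. -/
def tangentCoord (e : OpenPartialHomeomorph M (Vec n)) (v : TangentBundle (𝓡 n) M) :
    Vec n × Vec n :=
  (e v.1, mfderiv (𝓡 n) 𝓘(ℝ, Vec n) e v.1 v.2)

theorem mdifferentiableAt_tangentCoord (he : e ∈ IsManifold.maximalAtlas (𝓡 n) ∞ M)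
    {v : TangentBundle (𝓡 n) M} (hv : v.1 ∈ e.source) :
    MDifferentiableAt (𝓡 n).tangent 𝓘(ℝ, Vec n × Vec n) (tangentCoord e) v := by
  have hsource : (TotalSpace.proj ⁻¹' e.source : Set (TangentBundle (𝓡 n) M)) ∈ 𝓝 v :=
    (FiberBundle.continuous_proj _ _).continuousAt (e.open_source.mem_nhds hv)
  have hx : MDifferentiableAt (𝓡 n).tangent 𝓘(ℝ, Vec n)
      (fun w : TangentBundle (𝓡 n) M => e w.1) v :=
    ((mdifferentiable_of_mem_maximalAtlas he).mdifferentiableAt hv).comp v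
      (mdifferentiable_tangentBundle_proj M v)
  have htangent := (contMDiffOn_of_mem_maximalAtlas he).contMDiffOn_tangentMapWithin (m := 1)
    (by norm_cast) e.open_source.uniqueMDiffOn
  have hy : MDifferentiableAt (𝓡 n).tangent 𝓘(ℝ, Vec n)
      (fun w : TangentBundle (𝓡 n) M => (tangentMapWithin (𝓡 n) (𝓡 n) e e.source w).2) v :=
    ((contMDiff_snd_tangentBundle_modelSpace (n := 1) (Vec n) (𝓡 n)).contMDiffAt.comp v
      (htangent.contMDiffAt hsource)).mdifferentiableAt one_ne_zero
  refine (hx.prodMk_space hy).congr_of_eventuallyEq ?_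
  filter_upwards [hsource] with w hw
  rw [tangentCoord, tangentMapWithin, mfderivWithin_of_isOpen e.open_source hw]

theorem mfderiv_tangentCoord_fst (he : e ∈ IsManifold.maximalAtlas (𝓡 n) ∞ M)
    {v : TangentBundle (𝓡 n) M} (hv : v.1 ∈ e.source) (X : TangentSpace (𝓡 n).tangent v) :
    (mfderiv (𝓡 n).tangent 𝓘(ℝ, Vec n × Vec n) (tangentCoord e) v X : Vec n × Vec n).1 =
      mfderiv (𝓡 n) 𝓘(ℝ, Vec n) e v.1
        (mfderiv (𝓡 n).tangent (𝓡 n) (fun w : TangentBundle (𝓡 n) M => w.1) v X) := by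
  have hfst : HasMFDerivAt (𝓡 n).tangent 𝓘(ℝ, Vec n) (fun w => (tangentCoord e w).1) v _ :=
    HasMFDerivAt.comp (I' := 𝓘(ℝ, Vec n × Vec n)) v (g := Prod.fst)
      hasFDerivAt_fst.hasMFDerivAt (mdifferentiableAt_tangentCoord he hv).hasMFDerivAt
  have hproj := ((mdifferentiable_of_mem_maximalAtlas he).mdifferentiableAt hv).hasMFDerivAt.comp v
    (mdifferentiable_tangentBundle_proj M v).hasMFDerivAt
  exact DFunLike.congr_fun (hasMFDerivAt_unique hfst hproj) X

theorem mfderiv_tangentCoord_verticalLift (he : e ∈ IsManifold.maximalAtlas (𝓡 n) ∞ M)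
    {v : TangentBundle (𝓡 n) M} (hv : v.1 ∈ e.source) (X : TangentSpace (𝓡 n) v.1) :
    mfderiv (𝓡 n).tangent 𝓘(ℝ, Vec n × Vec n) (tangentCoord e) v (verticalLift v X) =
      ((0, mfderiv (𝓡 n) 𝓘(ℝ, Vec n) e v.1 X) : Vec n × Vec n) := by
  let T := modelTangentEquiv n v.1
  let L : Vec n →L[ℝ] Vec n :=
    (mfderiv (𝓡 n) 𝓘(ℝ, Vec n) e v.1).comp T.toContinuousLinearMap
  let fibre : Vec n → TangentBundle (𝓡 n) M := fun w => ⟨v.1, T w⟩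
  have hfibre : MDifferentiableAt 𝓘(ℝ, Vec n) (𝓡 n).tangent fibre (T.symm v.2) :=
    (contMDiff_totalSpaceMk_comp_clm (k := 1) T.toContinuousLinearMap).mdifferentiableAt one_ne_zero
  have hv' : fibre (T.symm v.2) = v := by simp only [fibre, T.apply_symm_apply]
  have hcoord : HasMFDerivAt 𝓘(ℝ, Vec n) 𝓘(ℝ, Vec n × Vec n) (tangentCoord e ∘ fibre) (T.symm v.2)
      ((0 : Vec n →L[ℝ] Vec n).prod L) :=
    ((hasFDerivAt_const (e v.1) _).prodMk L.hasFDerivAt).hasMFDerivAt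
  have hchain := mfderiv_comp_apply_of_eq (T.symm v.2) (mdifferentiableAt_tangentCoord he hv) hfibre
    hv' (T.symm X)
  rw [hcoord.mfderiv] at hchain
  rw [← verticalLiftCLM_apply]
  refine hchain.symm.trans ?_
  exact congrArg (fun w => ((0, mfderiv (𝓡 n) 𝓘(ℝ, Vec n) e v.1 w) : Vec n × Vec n))
    (T.apply_symm_apply X)

theorem isInvertible_mfderiv_tangentCoord (he : e ∈ IsManifold.maximalAtlas (𝓡 n) ∞ M)
    {v : TangentBundle (𝓡 n) M} (hv : v.1 ∈ e.source) :
    (mfderiv (𝓡 n).tangent 𝓘(ℝ, Vec n × Vec n) (tangentCoord e) v).IsInvertible := by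
  let D : Vec n × Vec n →L[ℝ] Vec n × Vec n :=
    mfderiv (𝓡 n).tangent 𝓘(ℝ, Vec n × Vec n) (tangentCoord e) v
  have hchart := (mdifferentiable_of_mem_maximalAtlas he).mfderiv_surjective hv
  have hD : Function.Surjective D := by
    rintro ⟨a, b⟩
    obtain ⟨w, hw⟩ := hchart a
    obtain ⟨X, hX⟩ := surjective_mfderiv_proj (IB := 𝓡 n) v w
    obtain ⟨w', hw'⟩ := hchart (b - (D X).2)
    have hDX : (D X).1 = a := (mfderiv_tangentCoord_fst he hv X).trans ((congrArg _ hX).trans hw)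
    have hDw' : D (verticalLift v w') = (0, b - (D X).2) :=
      (mfderiv_tangentCoord_verticalLift he hv w').trans (congrArg (Prod.mk 0) hw')
    refine ⟨X + verticalLift v w', (D.map_add X _).trans ?_⟩
    rw [hDw']
    exact Prod.ext ((add_zero _).trans hDX) (add_sub_cancel _ _)
  have hD' : Function.Injective D.toLinearMap := LinearMap.injective_iff_surjective.2 hD
  exact ⟨(LinearEquiv.ofInjectiveEndo D.toLinearMap hD').toContinuousLinearEquiv, rfl⟩

theorem mfderiv_bundleCoord (he : e ∈ IsManifold.maximalAtlas (𝓡 n) ∞ M) {p : SlitTM n M}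
    (hp : p.proj ∈ e.source) :
    mfderiv (𝓡 n).tangent 𝓘(ℝ, Vec n × Vec n) (bundleCoord e) p =
      (mfderiv (𝓡 n).tangent 𝓘(ℝ, Vec n × Vec n) (tangentCoord e) p.1).comp
        (opensTangentEquiv (𝓡 n).tangent p).toContinuousLinearMap :=
  mfderiv_comp_subtype_val (mdifferentiableAt_tangentCoord he hp)

theorem isInvertible_mfderiv_bundleCoord (he : e ∈ IsManifold.maximalAtlas (𝓡 n) ∞ M)
    {p : SlitTM n M} (hp : p.proj ∈ e.source) :
    (mfderiv (𝓡 n).tangent 𝓘(ℝ, Vec n × Vec n) (bundleCoord e) p).IsInvertible := by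
  rw [mfderiv_bundleCoord he hp]
  exact (isInvertible_mfderiv_tangentCoord he hp).comp ContinuousLinearMap.isInvertible_equiv

theorem dx_eq (he : e ∈ IsManifold.maximalAtlas (𝓡 n) ∞ M) {p : SlitTM n M}
    (hp : p.proj ∈ e.source) (i : Fin n) (X : TangentSpace (𝓡 n).tangent p) :
    dx e i p X =
      (mfderiv (𝓡 n).tangent 𝓘(ℝ, Vec n × Vec n) (bundleCoord e) p X : Vec n × Vec n).1 i := by
  have hcoord : MDifferentiableAt (𝓡 n).tangent 𝓘(ℝ, Vec n × Vec n) (bundleCoord e) p :=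
    (mdifferentiableAt_tangentCoord he hp).comp p (hasMFDerivAt_subtype_val p).mdifferentiableAt
  let ℓ : Vec n × Vec n →L[ℝ] ℝ :=
    (EuclideanSpace.proj i : Vec n →L[ℝ] ℝ).comp (ContinuousLinearMap.fst ℝ (Vec n) (Vec n))
  have h := (ℓ.hasFDerivAt (x := bundleCoord e p)).hasMFDerivAt.comp p hcoord.hasMFDerivAt
  exact DFunLike.congr_fun h.mfderiv X

theorem mfderiv_bundleCoord_slitTangent (he : e ∈ IsManifold.maximalAtlas (𝓡 n) ∞ M)
    {p : SlitTM n M} (hp : p.proj ∈ e.source) (X : TangentSpace (𝓡 n).tangent p) :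
    (mfderiv (𝓡 n).tangent 𝓘(ℝ, Vec n × Vec n) (bundleCoord e) p (slitTangent p X) :
        Vec n × Vec n) =
      (0, (mfderiv (𝓡 n).tangent 𝓘(ℝ, Vec n × Vec n) (bundleCoord e) p X : Vec n × Vec n).1) := by
  rw [mfderiv_bundleCoord he hp]
  refine (congrArg _ (opensTangentEquiv_slitTangent p X)).trans ?_
  exact (mfderiv_tangentCoord_verticalLift he hp _).trans
    (congrArg (Prod.mk 0) (mfderiv_tangentCoord_fst he hp _).symm)

theorem slitTangent_eq_sum_dx_smul_partialY (he : e ∈ IsManifold.maximalAtlas (𝓡 n) ∞ M)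
    {p : SlitTM n M} (hp : p.proj ∈ e.source) (X : TangentSpace (𝓡 n).tangent p) :
    slitTangent p X = ∑ i, dx e i p X • partialY e i p := by
  have hD := isInvertible_mfderiv_bundleCoord he hp
  have hY : ∀ i, mfderiv (𝓡 n).tangent 𝓘(ℝ, Vec n × Vec n) (bundleCoord e) p (partialY e i p) =
      ((0, stdVec i) : Vec n × Vec n) := fun i => hD.self_apply_inverse _
  have hsum : ∀ y : Vec n, ∑ i, y i • ((0, stdVec i) : Vec n × Vec n) = (0, y) := fun y => by
    simpa only [map_sum, map_smul, LinearMap.inr_apply] using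
      congrArg (LinearMap.inr ℝ (Vec n) (Vec n)) (sum_smul_stdVec y)
  apply hD.injective
  rw [map_sum]
  simp only [map_smul, hY, dx_eq he hp]
  exact (mfderiv_bundleCoord_slitTangent he hp X).trans (hsum _).symm

end Coordinates

end FrameTangent

end

open FrameTangent in
theorem mainTheorem3 (n : ℕ) (M : Type*) [TopologicalSpace M] [ChartedSpace (Vec n) M]
    [IsManifold (𝓡 n) ∞ M] (h : Metric n M) :
    -- the denominators do not vanish
    (∀ (u : LM n M) (ξ : Vec n), ξ ≠ 0 → ∑ a, ∑ b, hHat h u a b * ξ a * ξ b ≠ 0) ∧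
    -- every point of the slit tangent bundle is of the form `[u, ξ]` with `ξ ≠ 0`
    (∀ p : SlitTM n M, ∃ (u : LM n M) (ξ : Vec n) (hξ : ξ ≠ 0), psi ξ hξ u = p) ∧
    -- every `X` has a lift to the frame bundle
    (∀ (u : LM n M) (ξ : Vec n) (hξ : ξ ≠ 0) (X : TangentSpace (𝓡 n).tangent (psi ξ hξ u)),
      ∃ X' : TangentSpace (modelLM n) u,
        (mfderiv (modelLM n) (𝓡 n) LM.proj u X' : TangentSpace (𝓡 n) u.proj) =
          mfderiv (𝓡 n).tangent (𝓡 n) SlitTM.proj (psi ξ hξ u) X) ∧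
    -- the formula defines a vector-valued 1-form, independently of `u`, `ξ` and the lift
    ∃ J : ∀ p : SlitTM n M, TangentSpace (𝓡 n).tangent p →L[ℝ] TangentSpace (𝓡 n).tangent p,
      (∀ (u : LM n M) (ξ : Vec n) (hξ : ξ ≠ 0) (X : TangentSpace (𝓡 n).tangent (psi ξ hξ u))
        (X' : TangentSpace (modelLM n) u),
        (mfderiv (modelLM n) (𝓡 n) LM.proj u X' : TangentSpace (𝓡 n) u.proj) =
          mfderiv (𝓡 n).tangent (𝓡 n) SlitTM.proj (psi ξ hξ u) X →
        J (psi ξ hξ u) X =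
          (∑ a, ∑ b, hHat h u a b * ξ a * ξ b)⁻¹ •
            mfderiv (modelLM n) (𝓡 n).tangent (psi ξ hξ) u
              (∑ i, ξ i • covariantTangent h i u X')) ∧
      -- it is the restriction of the canonical tangent structure of the tangent bundle
      (∀ (p : SlitTM n M) (X : TangentSpace (𝓡 n).tangent p),
        mfderiv (𝓡 n).tangent (𝓡 n).tangent
            (Subtype.val : SlitTM n M → TangentBundle (𝓡 n) M) p (J p X) =
          canonicalTangent p.1
            (mfderiv (𝓡 n).tangent (𝓡 n).tangent
              (Subtype.val : SlitTM n M → TangentBundle (𝓡 n) M) p X)) ∧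
      -- in the coordinates induced by any chart it is `∂/∂yⁱ ⊗ dxⁱ`
      (∀ e ∈ IsManifold.maximalAtlas (𝓡 n) ∞ M, ∀ p : SlitTM n M, p.proj ∈ e.source →
        ∀ X : TangentSpace (𝓡 n).tangent p,
          J p X = ∑ i, dx e i p X • partialY e i p) :=
  ⟨fun u _ hξ => sum_hHat_ne_zero h u hξ,
    exists_psi_eq,
    exists_mfderiv_LM_proj_eq,
    slitTangent,
    slitTangent_psi_eq h,
    mfderiv_subtype_val_slitTangent,
    fun _ he _ hp X => slitTangent_eq_sum_dx_smul_partialY he hp X⟩
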